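/- Let $M$ be a smooth $n$-dimensional manifold and let $F:TM\to[0,\infty)$ be a Finsler structure on $M$: $F$ is smooth on the slit tangent bundle $N=TM\setminus\{0\}$, $F(x,\lambda y)=\lambda F(x,y)$ for all $\lambda>0$, and $g_{ij}(x,y)=\tfrac12\,\partial^2F^2/\partial y^i\partial y^j$ is positive definite on $N$. Let $\pi:N\to M$ be the projection. Put $A_{ijk}=\tfrac F2\,\partial g_{ij}/\partial y^k$, $\gamma^i_{jk}=\tfrac12 g^{is}\bigl(\partial_{x^k}g_{sj}-\partial_{x^s}g_{jk}+\partial_{x^j}g_{sk}\bigr)$, $N^i_j=\gamma^i_{jk}y^k-\tfrac1F A^i_{jk}\gamma^k_{rs}y^ry^s$, $\frac{\delta}{\delta x^j}=\frac{\partial}{\partial x^j}-N^i_j\frac{\partial}{\partial y^i}$ and $\delta y^i=dy^i+N^i_j\,dx^j$, and for $u\in N$ over $x$ let $\iota_u:T_xM\to T_uN$, $\iota_u(X^j\partial_{x^j})=X^j\frac{\delta}{\delta x^j}\big|_u$, be the horizontal lift. The Chern connection $\nabla^{ch}$ is the linear connection on the pull-back bundle $\pi^*TM\to N$ whose connection forms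 $\omega^i_j$ in natural coordinates satisfy $dx^j\wedge\omega^i_j=0$ and $dg_{ij}-g_{kj}\omega^k_i-g_{ik}\omega^k_j=2A_{ijk}\,\delta y^k/F$; thus $\omega^i_j=\Gamma^i_{jk}\,dx^k$ with $\Gamma^i_{jk}=\tfrac12 g^{is}\bigl(\frac{\delta g_{sj}}{\delta x^k}-\frac{\delta g_{jk}}{\delta x^s}+\frac{\delta g_{sk}}{\delta x^j}\bigr)$. The structure $F$ is of Berwald type if the coefficients $\Gamma^i_{jk}(x,y)$, written in natural coordinates, do not depend on $y$. For $x\in M$ let $I_x=\{y\in T_xM: F(x,y)=1\}$ be the indicatrix, with the volume $dvol$ induced on it from the Riemannian manifold $(T_xM\setminus\{0\},\,g_{ij}(x,y)\,dy^i dy^j)$. The averaged connection $\langle\nabla^{ch}\rangle$ is the linear connection on $M$ given by $$\langle\nabla^{ch}\rangle_XY=\frac1{\mathrm{vol}(I_x)}\int_{I_x}\nabla^{ch}_{\iota_u(X)}\pi^*Y\;dvol(u),\qquad X\in T_xM,$$ where the fibre of $\pi^*TM$ over $u$ is identified with $T_xM$. For a linear connection $\nabla$ on $M$, its pull-back $\pi^*\nabla$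 is the linear connection on $\pi^*TM$ with $(\pi^*\nabla)_{\iota(X)}\pi^*Y=\pi^*(\nabla_XY)$ and $(\pi^*\nabla)_V\pi^*Y=0$ for every vertical $V$. Then $F$ is of Berwald type if and only if $\pi^*\langle\nabla^{ch}\rangle=\nabla^{ch}$. -/

import Mathlib

open Bundle MeasureTheory Filter Topology
open scoped Manifold ContDiff

noncomputable section

namespace Finsler

/-! ### Finsler geometry in natural coordinates

A point `(x, y)` of the coordinate domain is a pair in `ℝⁿ × ℝⁿ`; `L` is the coordinate expression of
a Finsler function. Index conventions: `T L i j k p` is `T^i_{jk}(x, y)` or `T_{ijk}(x, y)` for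
`p = (x, y)`. -/

/-- The model space `ℝⁿ` of an `n`-dimensional manifold. -/
abbrev Model (n : ℕ) : Type := EuclideanSpace ℝ (Fin n)

section Coordinates

variable {n : ℕ}

/-- The `i`-th vector of the canonical basis of `ℝⁿ`. -/
def basisVec (i : Fin n) : Model n := EuclideanSpace.single i 1

/-- `∂f/∂xⁱ` for a function `f(x, y)`. -/
def dx (i : Fin n) (f : Model n × Model n → ℝ) (p : Model n × Model n) : ℝ :=
  fderiv ℝ f p (basisVec i, 0)

/-- `∂f/∂yⁱ` for a function `f(x, y)`. -/
def dy (i : Fin n) (f : Model n × Model n → ℝ) (p : Model n × Model n) : ℝ :=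
  fderiv ℝ f p (0, basisVec i)

variable (L : Model n × Model n → ℝ)

/-- `g_{ij} = ½ ∂²L²/∂yⁱ∂yʲ`. -/
def metricCoeff (p : Model n × Model n) : Matrix (Fin n) (Fin n) ℝ :=
  Matrix.of fun i j => (1 / 2) * dy i (dy j (fun q => L q ^ 2)) p

/-- `g^{ij}`, the inverse matrix of `g_{ij}`. -/
def metricInv (p : Model n × Model n) : Matrix (Fin n) (Fin n) ℝ :=
  (metricCoeff L p)⁻¹

/-- The Cartan tensor `A_{ijk} = (L/2) ∂g_{ij}/∂yᵏ`. -/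
def cartanCoeff (i j k : Fin n) (p : Model n × Model n) : ℝ :=
  L p / 2 * dy k (fun q => metricCoeff L q i j) p

/-- `A^i_{jk} = g^{il} A_{ljk}`. -/
def cartanCoeffUp (i j k : Fin n) (p : Model n × Model n) : ℝ :=
  ∑ l, metricInv L p i l * cartanCoeff L l j k p

/-- The formal Christoffel symbols of the second kind,
`γ^i_{jk} = ½ g^{is} (∂g_{sj}/∂xᵏ - ∂g_{jk}/∂xˢ + ∂g_{sk}/∂xʲ)`. -/
def formalChristoffel (i j k : Fin n) (p : Model n × Model n) : ℝ :=
  (1 / 2) * ∑ s, metricInv L p i s *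
    (dx k (fun q => metricCoeff L q s j) p - dx s (fun q => metricCoeff L q j k) p
      + dx j (fun q => metricCoeff L q s k) p)

/-- The coefficients of the non-linear connection,
`N^i_j / L = γ^i_{jk} yᵏ / L - A^i_{jk} γ^k_{rs} (yʳ / L) (yˢ / L)`. -/
def nonlinearCoeff (i j : Fin n) (p : Model n × Model n) : ℝ :=
  L p * (∑ k, formalChristoffel L i j k p * (p.2 k / L p)
    - ∑ k, ∑ r, ∑ s, cartanCoeffUp L i j k p * formalChristoffel L k r s p
        * (p.2 r / L p) * (p.2 s / L p))

/-- `δf/δxʲ = ∂f/∂xʲ - N^i_j ∂f/∂yⁱ`. -/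
def deltaX (j : Fin n) (f : Model n × Model n → ℝ) (p : Model n × Model n) : ℝ :=
  dx j f p - ∑ i, nonlinearCoeff L i j p * dy i f p

/-- The coefficients of the Chern connection,
`Γ^i_{jk} = ½ g^{is} (δg_{sj}/δxᵏ - δg_{jk}/δxˢ + δg_{sk}/δxʲ)`. -/
def chernCoeff (i j k : Fin n) (p : Model n × Model n) : ℝ :=
  (1 / 2) * ∑ s, metricInv L p i s *
    (deltaX L k (fun q => metricCoeff L q s j) p - deltaX L s (fun q => metricCoeff L q j k) p
      + deltaX L j (fun q => metricCoeff L q s k) p)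

/-- The connection forms `ω^i_j = G^i_{jk} dxᵏ` (no `dy`-terms) satisfy at `p` the structure equations
of the Chern connection: torsion-freeness `dxʲ ∧ ω^i_j = 0`, that is `G^i_{jk} = G^i_{kj}`, and almost
compatibility `dg_{ij} - g_{lj} ω^l_i - g_{il} ω^l_j = 2 A_{ijk} δyᵏ / L`. The two sides of the latter
are compared on the frame `δ/δxᵏ`, `∂/∂yᵏ`. -/
structure StructureEquations (G : Fin n → Fin n → Fin n → ℝ) (p : Model n × Model n) : Prop where
  torsionFree : ∀ i j k, G i j k = G i k j
  horizontal : ∀ i j k, deltaX L k (fun q => metricCoeff L q i j) p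
    - ∑ l, metricCoeff L p l j * G l i k - ∑ l, metricCoeff L p i l * G l j k = 0
  vertical : ∀ i j k, dy k (fun q => metricCoeff L q i j) p = 2 * cartanCoeff L i j k p / L p

variable {L}

theorem deltaX_congr {f f' : Model n × Model n → ℝ} {p : Model n × Model n}
    (h : f =ᶠ[𝓝 p] f') (k : Fin n) : deltaX L k f p = deltaX L k f' p := by
  simp only [deltaX, dx, dy, h.fderiv_eq]

/-- The coefficients `Γ^i_{jk}` satisfy the structure equations, and they are the only ones. -/
theorem structureEquations_iff {p : Model n × Model n} (hL : L p ≠ 0)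
    (hdet : IsUnit (metricCoeff L p).det)
    (hsymm : ∀ᶠ q in 𝓝 p, (metricCoeff L q).IsSymm) (G : Fin n → Fin n → Fin n → ℝ) :
    StructureEquations L G p ↔ ∀ i j k, G i j k = chernCoeff L i j k p := by
  have hs : ∀ a b, metricCoeff L p a b = metricCoeff L p b a :=
    fun a b => (hsymm.self_of_nhds.apply b a)
  have hd : ∀ k a b, deltaX L k (fun q => metricCoeff L q a b) p
      = deltaX L k (fun q => metricCoeff L q b a) p := fun k a b =>
    deltaX_congr (hsymm.mono fun q hq => hq.apply b a) k
  have hinv : metricInv L p * metricCoeff L p = 1 := Matrix.nonsing_inv_mul _ hdet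
  have hinv' : metricCoeff L p * metricInv L p = 1 := Matrix.mul_nonsing_inv _ hdet
  have hvert : ∀ i j k, dy k (fun q => metricCoeff L q i j) p = 2 * cartanCoeff L i j k p / L p := by
    intro i j k
    rw [cartanCoeff]
    field_simp
  constructor
  · intro h i j k
    have key : ∀ s, deltaX L k (fun q => metricCoeff L q s j) p
        - deltaX L s (fun q => metricCoeff L q j k) p + deltaX L j (fun q => metricCoeff L q s k) p
        = 2 * ∑ l, metricCoeff L p s l * G l j k := by
      intro s
      have e1 := h.horizontal s j k
      have e2 := h.horizontal j k s
      have e3 := h.horizontal s k j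
      have f1 : ∑ l, metricCoeff L p l k * G l j s = ∑ l, metricCoeff L p l k * G l s j :=
        Finset.sum_congr rfl fun l _ => by rw [h.torsionFree l j s]
      have f2 : ∑ l, metricCoeff L p j l * G l k s = ∑ l, metricCoeff L p l j * G l s k :=
        Finset.sum_congr rfl fun l _ => by rw [h.torsionFree l k s, hs]
      have f3 : ∑ l, metricCoeff L p s l * G l k j = ∑ l, metricCoeff L p s l * G l j k :=
        Finset.sum_congr rfl fun l _ => by rw [h.torsionFree l k j]
      linarith
    have e : chernCoeff L i j k p
        = ∑ s, metricInv L p i s * ∑ l, metricCoeff L p s l * G l j k := by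
      rw [chernCoeff, Finset.mul_sum]
      refine Finset.sum_congr rfl fun s _ => ?_
      rw [key s]
      ring
    rw [e]
    have hm : (metricInv L p).mulVec ((metricCoeff L p).mulVec fun l => G l j k)
        = fun l => G l j k := by
      rw [Matrix.mulVec_mulVec, hinv, Matrix.one_mulVec]
    exact (congrFun hm i).symm
  · intro h
    have low : ∀ s j k, ∑ l, metricCoeff L p s l * G l j k
        = (1 / 2) * (deltaX L k (fun q => metricCoeff L q s j) p
          - deltaX L s (fun q => metricCoeff L q j k) p
          + deltaX L j (fun q => metricCoeff L q s k) p) := by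
      intro s j k
      have hm : (metricCoeff L p).mulVec ((metricInv L p).mulVec fun s =>
          (1 / 2) * (deltaX L k (fun q => metricCoeff L q s j) p
          - deltaX L s (fun q => metricCoeff L q j k) p
          + deltaX L j (fun q => metricCoeff L q s k) p)) = fun s =>
          (1 / 2) * (deltaX L k (fun q => metricCoeff L q s j) p
          - deltaX L s (fun q => metricCoeff L q j k) p
          + deltaX L j (fun q => metricCoeff L q s k) p) := by
        rw [Matrix.mulVec_mulVec, hinv', Matrix.one_mulVec]
      refine Eq.trans (Finset.sum_congr rfl fun l _ => ?_) (congrFun hm s)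
      rw [h, chernCoeff, Finset.mul_sum]
      congr 1
      exact Finset.sum_congr rfl fun s _ => by ring
    refine ⟨?_, ?_, hvert⟩
    · intro i j k
      rw [h, h, chernCoeff, chernCoeff]
      congr 1
      refine Finset.sum_congr rfl fun s _ => ?_
      rw [hd s j k]
      ring
    · intro i j k
      have e : ∑ l, metricCoeff L p l j * G l i k = ∑ l, metricCoeff L p j l * G l i k :=
        Finset.sum_congr rfl fun l _ => by rw [hs]
      rw [e, low, low, hd k j i, hd j i k, hd i j k]
      ring

end Coordinates

/-! ### The slit tangent bundle and the pull-back bundle -/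

section Manifold

variable (n : ℕ) (M : Type*) [TopologicalSpace M] [ChartedSpace (Model n) M]
  [IsManifold (𝓡 n) ∞ M]

/-- The slit tangent bundle is open in the tangent bundle. -/
theorem isOpen_slit : IsOpen {u : TangentBundle (𝓡 n) M | u.2 ≠ 0} := by
  rw [isOpen_iff_mem_nhds]
  intro u hu
  let e := trivializationAt (Model n) (TangentSpace (𝓡 n) : M → Type) u.1
  have hmem : ∀ v : TangentBundle (𝓡 n) M, v.1 ∈ e.baseSet → ((e v).2 ≠ 0 ↔ v.2 ≠ 0) := by
    intro v hv
    have h : (e v).2 = e.continuousLinearEquivAt ℝ v.1 hv v.2 := rfl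
    rw [h, Ne, map_eq_zero_iff _ (e.continuousLinearEquivAt ℝ v.1 hv).injective]
  have hu' : u.1 ∈ e.baseSet := FiberBundle.mem_baseSet_trivializationAt' u.1
  have hsrc : u ∈ e.source := e.mem_source.2 hu'
  have hc : ContinuousAt (fun v => (e v).2) u := (e.continuousAt hsrc).snd
  have h1 := hc.eventually_ne ((hmem u hu').2 hu)
  filter_upwards [h1, e.open_source.mem_nhds hsrc] with v hv hv'
  exact (hmem v (e.mem_source.1 hv')).1 hv

/-- The slit tangent bundle `N = TM \ 0`, an open submanifold of `TM`. -/
def Slit : TopologicalSpace.Opens (TangentBundle (𝓡 n) M) :=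
  ⟨{u | u.2 ≠ 0}, isOpen_slit n M⟩

/-- The projection `π : N → M`. -/
def slitProj : C(Slit n M, M) :=
  ⟨fun u => u.1.proj, (FiberBundle.continuous_proj (Model n) (TangentSpace (𝓡 n))).comp
    continuous_subtype_val⟩

/-- The pull-back bundle `π*TM → N`. -/
abbrev PullbackTangent : Slit n M → Type :=
  (slitProj n M) *ᵖ (TangentSpace (𝓡 n) : M → Type)

instance (u : Slit n M) : AddCommGroup (PullbackTangent n M u) :=
  inferInstanceAs (AddCommGroup (TangentSpace (𝓡 n) (slitProj n M u)))

instance (u : Slit n M) : IsTopologicalAddGroup (PullbackTangent n M u) :=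
  inferInstanceAs (IsTopologicalAddGroup (TangentSpace (𝓡 n) (slitProj n M u)))

instance (u : Slit n M) : ContinuousSMul ℝ (PullbackTangent n M u) :=
  inferInstanceAs (ContinuousSMul ℝ (TangentSpace (𝓡 n) (slitProj n M u)))

/-- Linear connections on the vector bundle `π*TM → N`, as covariant derivatives. The value
`∇_X̃ S` at `u` is written `D S u X̃`. -/
abbrev PullbackConnection : Type _ :=
  CovariantDerivative (𝓡 n).tangent (Model n) (PullbackTangent n M)

variable {n M}

/-- The point of `N` given by a non-zero tangent vector `y` at `x`. -/
def slitPoint (x : M) (y : TangentSpace (𝓡 n) x) (hy : y ≠ 0) : Slit n M := ⟨⟨x, y⟩, hy⟩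

/-- The section `π*Y` of `π*TM` given by a vector field `Y` on `M`. -/
def pullbackField (Y : Π x : M, TangentSpace (𝓡 n) x) : Π u : Slit n M, PullbackTangent n M u :=
  fun u => Y (slitProj n M u)

/-! ### Natural coordinates -/

/-- The natural coordinates `(x, y)` on `TM` induced by a chart `φ` of `M`. -/
def natCoord (φ : OpenPartialHomeomorph M (Model n)) (u : TangentBundle (𝓡 n) M) :
    Model n × Model n :=
  (φ u.1, mvfderiv (𝓡 n) φ u.1 u.2)

/-- The tangent vector with natural coordinates `p = (x, y)` in the chart `φ`. -/
def natPoint (φ : OpenPartialHomeomorph M (Model n)) (p : Model n × Model n) :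
    TangentBundle (𝓡 n) M :=
  ⟨φ.symm p.1, mfderiv 𝓘(ℝ, Model n) (𝓡 n) φ.symm p.1 p.2⟩

/-- The coordinate vector field `∂/∂xʲ` of the chart `φ` (relevant on the domain of `φ` only). -/
def coordField (φ : OpenPartialHomeomorph M (Model n)) (j : Fin n) (x : M) :
    TangentSpace (𝓡 n) x :=
  (mvfderiv (𝓡 n) φ x).inverse (basisVec j)

/-- The components `dxⁱ(v)` of a tangent vector `v` in the chart `φ`. -/
def component (φ : OpenPartialHomeomorph M (Model n)) {x : M} (v : TangentSpace (𝓡 n) x)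
    (i : Fin n) : ℝ :=
  (mvfderiv (𝓡 n) φ x v) i

/-- The bilinear map `(c, v) ↦ G^i_{jk} cʲ vᵏ eᵢ` of `ℝⁿ`. -/
def coeffForm (G : Fin n → Fin n → Fin n → ℝ) : Model n →L[ℝ] Model n →L[ℝ] Model n :=
  ∑ i, ∑ j, ∑ k, G i j k • (EuclideanSpace.proj j : Model n →L[ℝ] ℝ).smulRight
    ((EuclideanSpace.proj k : Model n →L[ℝ] ℝ).smulRight (basisVec i))

/-- The components `Sⁱ`, near `π(u)`, of a section `S` of `π*TM` in the frame `π*(∂/∂xⁱ)` of the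
preferred chart at `π(u)`. -/
def sectionCoord (u : Slit n M) (S : Π u : Slit n M, PullbackTangent n M u) (u' : Slit n M) :
    Model n :=
  (trivializationAt (Model n) (PullbackTangent n M) u ⟨u', S u'⟩).2

theorem sectionCoord_eventually (u : Slit n M) : ∀ᶠ u' in 𝓝 u, ∀ S, sectionCoord u S u'
    = (trivializationAt (Model n) (PullbackTangent n M) u).continuousLinearMapAt ℝ u' (S u') := by
  have ho := (trivializationAt (Model n) (PullbackTangent n M) u).open_baseSet.mem_nhds
    (FiberBundle.mem_baseSet_trivializationAt' u)
  filter_upwards [ho] with u' hu' S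
  rw [Trivialization.continuousLinearMapAt_apply, Trivialization.linearMapAt_apply, if_pos hu']
  rfl

theorem symmL_sectionCoord (u : Slit n M) (S : Π u : Slit n M, PullbackTangent n M u) :
    (trivializationAt (Model n) (PullbackTangent n M) u).symmL ℝ u (sectionCoord u S u) = S u := by
  rw [(sectionCoord_eventually u).self_of_nhds S]
  exact Trivialization.symmL_continuousLinearMapAt _
    (FiberBundle.mem_baseSet_trivializationAt' u) _

theorem mdifferentiableAt_sectionCoord {u : Slit n M} {S : Π u : Slit n M, PullbackTangent n M u}
    (hS : MDifferentiableAt (𝓡 n).tangent ((𝓡 n).tangent.prod 𝓘(ℝ, Model n))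
      (fun u => (⟨u, S u⟩ : TotalSpace (Model n) (PullbackTangent n M))) u) :
    MDifferentiableAt (𝓡 n).tangent 𝓘(ℝ, Model n) (sectionCoord u S) u :=
  (mdifferentiableAt_section _ S).1 hS

section Auxiliary

variable {V W : Type*} [AddCommGroup V] [Module ℝ V] [TopologicalSpace V] [IsTopologicalAddGroup V]
  [AddCommGroup W] [Module ℝ W] [TopologicalSpace W]

theorem connection_add_aux (T : Model n →L[ℝ] V) (d d' : W →L[ℝ] Model n)
    (B : Model n →L[ℝ] Model n →L[ℝ] Model n) (e : W →L[ℝ] Model n) (c c' : Model n) :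
    T.comp (d + d' + (B (c + c')).comp e) = T.comp (d + (B c).comp e) + T.comp (d' + (B c').comp e) := by
  ext1 v
  simp
  abel

theorem connection_smul_aux [ContinuousSMul ℝ V] (T : Model n →L[ℝ] V) (d d' : W →L[ℝ] Model n)
    (δ : W →L[ℝ] ℝ) (B : Model n →L[ℝ] Model n →L[ℝ] Model n) (e : W →L[ℝ] Model n)
    (c c' : Model n) (a : ℝ) (s : V) (hs : T c = s) (hc : c' = a • c)
    (hd : d' = a • d + δ.smulRight c) :
    T.comp (d' + (B c').comp e) = a • T.comp (d + (B c).comp e) + δ.smulRight s := by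
  subst hc hd
  ext1 v
  simp [hs]
  module

end Auxiliary

/-- The linear connection on `π*TM` whose connection forms at `u`, in the natural coordinates of the
preferred chart at `π(u)`, are `ω^i_j = G^i_{jk}(u) dxᵏ`:
`∇_X̃ S = (dSⁱ(X̃) + G^i_{jk}(u) Sʲ dxᵏ(X̃)) π*(∂/∂xⁱ)`. -/
def connectionOfCoeff (G : Slit n M → Fin n → Fin n → Fin n → ℝ) : PullbackConnection n M where
  toFun S u :=
    ((trivializationAt (Model n) (PullbackTangent n M) u).symmL ℝ u).comp
      (mvfderiv (𝓡 n).tangent (sectionCoord u S) u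
        + (coeffForm (G u) (sectionCoord u S u)).comp
          (mvfderiv (𝓡 n).tangent
            (fun u' : Slit n M => chartAt (Model n) (slitProj n M u) (slitProj n M u')) u))
  isCovariantDerivativeOnUniv := by
    refine ⟨?_, ?_⟩
    · intro S S' u hS hS' _
      have h : sectionCoord u (S + S') =ᶠ[𝓝 u] sectionCoord u S + sectionCoord u S' := by
        filter_upwards [sectionCoord_eventually u] with u' hu'
        rw [Pi.add_apply, hu', hu', hu']
        exact map_add _ _ _
      have hd : mvfderiv (𝓡 n).tangent (sectionCoord u (S + S')) u
          = mvfderiv (𝓡 n).tangent (sectionCoord u S) u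
            + mvfderiv (𝓡 n).tangent (sectionCoord u S') u := by
        rw [← mvfderiv_add (mdifferentiableAt_sectionCoord hS) (mdifferentiableAt_sectionCoord hS'),
          mvfderiv, mvfderiv, h.mfderiv_eq, h.self_of_nhds]
      rw [hd, h.self_of_nhds]
      exact connection_add_aux _ _ _ _ _ _ _
    · intro S f u hS hf _
      have h : sectionCoord u (f • S) =ᶠ[𝓝 u] f • sectionCoord u S := by
        filter_upwards [sectionCoord_eventually u] with u' hu'
        rw [Pi.smul_apply', hu', hu']
        exact ContinuousLinearMap.map_smul _ _ _
      have hd : mvfderiv (𝓡 n).tangent (sectionCoord u (f • S)) u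
          = f u • mvfderiv (𝓡 n).tangent (sectionCoord u S) u
            + (mvfderiv (𝓡 n).tangent f u).smulRight (sectionCoord u S u) := by
        rw [← mvfderiv_smul hf (mdifferentiableAt_sectionCoord hS),
          mvfderiv, mvfderiv, h.mfderiv_eq, h.self_of_nhds]
      have hc : sectionCoord u (f • S) u = f u • sectionCoord u S u := h.self_of_nhds
      exact connection_smul_aux _ _ _ _ _ _ _ _ _ _ (symmL_sectionCoord u S) hc hd

/-! ### Finsler structures -/

/-- The fundamental tensor `g_{(x,y)}(v, w) = ½ ∂²F²(x, y + s v + t w)/∂s∂t` at `s = t = 0`, that is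
`½ (∂²F²/∂yⁱ∂yʲ) vⁱ wʲ`. -/
def fundamentalTensor (F : TangentBundle (𝓡 n) M → ℝ) (x : M) (y v w : TangentSpace (𝓡 n) x) : ℝ :=
  (1 / 2) * lineDeriv ℝ (fun y' => lineDeriv ℝ (fun z => F ⟨x, z⟩ ^ 2) y' w) y v

variable (n M)

/-- A Finsler structure on `M`: a non-negative function on `TM`, smooth on `TM \ 0`, positively
homogeneous of degree one and strongly convex. -/
structure FinslerStructure where
  /-- The Finsler function. -/
  toFun : TangentBundle (𝓡 n) M → ℝ
  nonneg : ∀ u, 0 ≤ toFun u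
  smooth : ContMDiffOn (𝓡 n).tangent 𝓘(ℝ, ℝ) ∞ toFun {u | u.2 ≠ 0}
  homogeneous : ∀ (x : M) (y : TangentSpace (𝓡 n) x) (c : ℝ), 0 < c →
    toFun ⟨x, c • y⟩ = c * toFun ⟨x, y⟩
  stronglyConvex : ∀ (x : M) (y v : TangentSpace (𝓡 n) x), y ≠ 0 → v ≠ 0 →
    0 < fundamentalTensor toFun x y v v

variable {n M}

namespace FinslerStructure

variable (F : FinslerStructure n M)

theorem apply_zero (x : M) : F.toFun ⟨x, 0⟩ = 0 := by
  have h := F.homogeneous x 0 2 two_pos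
  rw [smul_zero] at h
  linarith

/-- A Finsler function is positive on non-zero vectors. -/
theorem pos (x : M) (y : TangentSpace (𝓡 n) x) (hy : y ≠ 0) : 0 < F.toFun ⟨x, y⟩ := by
  refine (F.nonneg _).lt_of_ne' fun h0 => ?_
  have hconv := F.stronglyConvex x y y hy hy
  have hray : ∀ c : ℝ, 0 < c → F.toFun ⟨x, c • y⟩ = 0 := fun c hc => by
    rw [F.homogeneous x y c hc, h0, mul_zero]
  have hline : ∀ c : ℝ, 0 < c →
      lineDeriv ℝ (fun z => F.toFun ⟨x, z⟩ ^ 2) (c • y) y = 0 := by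
    intro c hc
    have h : (fun t : ℝ => F.toFun ⟨x, c • y + t • y⟩ ^ 2) =ᶠ[𝓝 0] fun _ => (0 : ℝ) := by
      have hp : ∀ᶠ t : ℝ in 𝓝 0, -c < t := eventually_gt_nhds (by linarith)
      filter_upwards [hp] with t ht
      rw [← add_smul, hray _ (by linarith), zero_pow two_ne_zero]
    rw [lineDeriv, h.deriv_eq, deriv_const]
  have h : (fun t : ℝ => lineDeriv ℝ (fun z => F.toFun ⟨x, z⟩ ^ 2) (y + t • y) y)
      =ᶠ[𝓝 0] fun _ => (0 : ℝ) := by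
    have hp : ∀ᶠ t : ℝ in 𝓝 0, -1 < t := eventually_gt_nhds (by norm_num)
    filter_upwards [hp] with t ht
    have he : y + t • y = (1 + t) • y := by rw [add_smul, one_smul]
    rw [he]
    exact hline _ (by linarith)
  rw [fundamentalTensor, lineDeriv, h.deriv_eq, deriv_const, mul_zero] at hconv
  exact lt_irrefl _ hconv

/-- The expression of `F` in the natural coordinates of a chart. -/
def inChart (φ : OpenPartialHomeomorph M (Model n)) (p : Model n × Model n) : ℝ :=
  F.toFun (natPoint φ p)

/-! ### The non-linear connection and the Chern connection -/

/-- The horizontal lift `ι_u : T_xM → T_uN`, `Xʲ ∂/∂xʲ ↦ Xʲ δ/δxʲ = Xʲ (∂/∂xʲ - N^i_j ∂/∂yⁱ)`, for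
`u ∈ N` over `x`. The formula is in the natural coordinates of the preferred chart at `x`; these are
the coordinates in which `T_xM` is `ℝⁿ` and `T_uN` is `ℝⁿ × ℝⁿ` in Mathlib. -/
def horizontalLift (u : Slit n M) :
    TangentSpace (𝓡 n) (slitProj n M u) →L[ℝ] TangentSpace (𝓡 n).tangent u :=
  let φ := chartAt (Model n) (slitProj n M u)
  let N : Model n →L[ℝ] Model n :=
    ∑ i, ∑ j, nonlinearCoeff (F.inChart φ) i j (natCoord φ u.1) •
      (EuclideanSpace.proj j : Model n →L[ℝ] ℝ).smulRight (basisVec i)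
  show Model n →L[ℝ] Model n × Model n from (ContinuousLinearMap.id ℝ (Model n)).prod (-N)

/-- The Chern connection of `F` on `π*TM`: its connection forms are `ω^i_j = Γ^i_{jk} dxᵏ`, with the
coefficients `Γ^i_{jk}` that solve the structure equations in natural coordinates (see
`structureEquations_iff`). The `Γ^i_{jk}` obey the transformation law of connection coefficients, so
any chart around `π(u)` may be used at `u`; the preferred one is taken. -/
def chernConnection : PullbackConnection n M :=
  connectionOfCoeff fun u i j k =>
    chernCoeff (F.inChart (chartAt (Model n) (slitProj n M u))) i j k
      (natCoord (chartAt (Model n) (slitProj n M u)) u.1)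

/-- The coefficients `Γ^i_{jk} = dxⁱ(∇_{δ/δxᵏ} π*(∂/∂xʲ))` at `u` of a linear connection on `π*TM` in
the natural coordinates of a chart `φ`. -/
def connectionCoeff (D : PullbackConnection n M) (φ : OpenPartialHomeomorph M (Model n))
    (u : Slit n M) (i j k : Fin n) : ℝ :=
  component φ (x := slitProj n M u) (D (pullbackField (coordField φ j)) u
    (F.horizontalLift u (coordField φ k (slitProj n M u)))) i

/-- `F` is of Berwald type: in all natural coordinates, the coefficients `Γ^i_{jk}(x, y)` of the Chern
connection do not depend on `y`. -/
def IsBerwald : Prop :=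
  ∀ φ ∈ IsManifold.maximalAtlas (𝓡 n) ∞ M, ∀ x ∈ φ.source,
    ∀ (y y' : TangentSpace (𝓡 n) x) (hy : y ≠ 0) (hy' : y' ≠ 0) (i j k : Fin n),
      F.connectionCoeff F.chernConnection φ (slitPoint x y hy) i j k
        = F.connectionCoeff F.chernConnection φ (slitPoint x y' hy') i j k

/-! ### The averaged connection -/

/-- The indicatrix `I_x = {y ∈ T_xM | F(x, y) = 1}`. The space `T_xM` is identified with `ℝⁿ`
by the coordinates of the preferred chart at `x`, as everywhere in Mathlib. -/
def indicatrix (x : M) : Set (Model n) := {y | F.toFun ⟨x, y⟩ = 1}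

variable {F} in
theorem ne_zero_of_mem_indicatrix {x : M} {y : Model n} (hy : y ∈ F.indicatrix x) : y ≠ 0 := by
  rintro rfl
  have h : F.toFun ⟨x, 0⟩ = 1 := hy
  rw [F.apply_zero] at h
  exact zero_ne_one h

/-- The Riemannian volume `√(det g_{ij}(x, y)) dy¹ ⋯ dyⁿ` of the Riemannian manifold
`(T_xM \ 0, g_x)`. -/
def fiberVolume (x : M) : Measure (Model n) :=
  volume.withDensity fun y => ENNReal.ofReal
    (Real.sqrt (Matrix.of fun i j =>
      fundamentalTensor F.toFun x y (basisVec i) (basisVec j)).det)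

/-- The radial projection `y ↦ y / F(x, y)` of `T_xM \ 0` onto the indicatrix. -/
def radialProj (x : M) (y : {y : Model n // y ≠ 0}) : F.indicatrix x :=
  ⟨(F.toFun ⟨x, y.1⟩)⁻¹ • y.1, by
    have h := F.pos x y.1 y.2
    have h' := F.homogeneous x y.1 _ (inv_pos.2 h)
    rw [inv_mul_cancel₀ h.ne'] at h'
    exact h'⟩

/-- The volume `dvol` on `I_x` induced from the Riemannian manifold `(T_xM \ 0, g_x)`. Along `I_x` the
position vector `y` is the `g_x`-unit normal, and `g_{(x,y)}` is homogeneous of degree zero in `y`, so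
in polar coordinates `(t, y) ↦ t y`, `y ∈ I_x`, the Riemannian volume is `t^(n-1) dt dvol(y)`. Hence
`dvol(A)` is `n` times the Riemannian volume of the cone `{t y | y ∈ A, 0 < t < 1}`. -/
def indicatrixVolume (x : M) : Measure (F.indicatrix x) :=
  (n : ENNReal) • Measure.map (F.radialProj x)
    (Measure.comap Subtype.val ((F.fiberVolume x).restrict {y | F.toFun ⟨x, y⟩ < 1}))

/-- The average `<D>` of a linear connection `D` on `π*TM`, an operator on the vector fields of `M`:
`<D>_X Y = vol(I_x)⁻¹ ∫_{I_x} D_{ι_u(X)} π*Y dvol(u)` for `X ∈ T_xM`. The value `<D>_X Y` at `x` is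
written `F.average D Y x X`. -/
def average (D : PullbackConnection n M) (Y : Π x : M, TangentSpace (𝓡 n) x) (x : M) :
    TangentSpace (𝓡 n) x →L[ℝ] TangentSpace (𝓡 n) x :=
  show Model n →L[ℝ] Model n from
    ⨍ y : F.indicatrix x,
      (show Model n →L[ℝ] Model n from
        (D (pullbackField Y) (slitPoint x y.1 (ne_zero_of_mem_indicatrix y.2))).comp
          (F.horizontalLift (slitPoint x y.1 (ne_zero_of_mem_indicatrix y.2))))
      ∂(F.indicatrixVolume x)

end FinslerStructure

/-! ### The pull-back of a connection -/

/-- The (horizontal) pull-back to `π*TM` of a linear connection `D` on `M` (an operator on vector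
fields whose value `D_X Y` at `x` is written `D Y x X`). It is the linear connection with
`(π*D)_{ι(X)} π*Y = π*(D_X Y)` and `(π*D)_V π*Y = 0` for vertical `V`: its connection forms are
`ω^i_j = Γ^i_{jk} dxᵏ`, where `D_{∂/∂xᵏ} (∂/∂xʲ) = Γ^i_{jk} ∂/∂xⁱ`. -/
def pullbackConnection
    (D : (Π x : M, TangentSpace (𝓡 n) x) →
      (Π x : M, TangentSpace (𝓡 n) x →L[ℝ] TangentSpace (𝓡 n) x)) :
    PullbackConnection n M :=
  connectionOfCoeff fun u i j k =>
    let x := slitProj n M u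
    let φ := chartAt (Model n) x
    component φ (D (coordField φ j) x (coordField φ k x)) i

/-! ### The defining property of the pull-back -/

theorem continuousLinearMapAt_eq_mvfderiv {x x' : M} (h : x' ∈ (chartAt (Model n) x).source) :
   (trivializationAt (Model n) (TangentSpace (𝓡 n)) x).continuousLinearMapAt ℝ x' =
    mvfderiv (𝓡 n) (chartAt (Model n) x) x' := by
  rw [TangentBundle.continuousLinearMapAt_trivializationAt h]
  ext1 v
  simp [mvfderiv, extChartAt]
  rfl

theorem coordField_chartAt {x x' : M} (h : x' ∈ (chartAt (Model n) x).source) (j) :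
   coordField (chartAt (Model n) x) j x' =
   (trivializationAt (Model n) (TangentSpace (𝓡 n)) x).symmL ℝ x' (basisVec j) := by
  rw [coordField, ← continuousLinearMapAt_eq_mvfderiv h]
  have h' : x' ∈ (trivializationAt (Model n) (TangentSpace (𝓡 n)) x).baseSet := h
  rw [ContinuousLinearMap.inverse_eq (g := (trivializationAt (Model n) (TangentSpace (𝓡 n)) x).symmL ℝ x')]
  · ext1 v; exact Trivialization.continuousLinearMapAt_symmL _ h' v
  · ext1 v; exact Trivialization.symmL_continuousLinearMapAt _ h' v

theorem mdifferentiableAt_slitProj (u : Slit n M) : MDifferentiableAt (𝓡 n).tangent (𝓡 n) (slitProj n M) u := by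
  have h1 : MDifferentiableAt (𝓡 n).tangent (𝓡 n) (fun v : TangentBundle (𝓡 n) M => v.1) u.1 :=
    mdifferentiableAt_proj _
  have h2 : MDifferentiableAt (𝓡 n).tangent (𝓡 n).tangent (Subtype.val : Slit n M → _) u :=
    (contMDiff_subtype_val (n := 1)).mdifferentiable (by norm_num) u
  exact h1.comp u h2

theorem sectionCoord_pullbackField (Y : Π x : M, TangentSpace (𝓡 n) x) (u : Slit n M) :
   sectionCoord u (pullbackField Y) = (fun x => (trivializationAt (Model n) (TangentSpace (𝓡 n)) (slitProj n M u) ⟨x, Y x⟩).2) ∘ slitProj n M := rfl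

/-- In the coordinates of Mathlib, the differential of `π` is `(X, V) ↦ X`. -/
theorem mfderiv_slitProj (u : Slit n M) (X : Model n × Model n) :
   mfderiv (𝓡 n).tangent (𝓡 n) (slitProj n M) u X = (X.1 : Model n) := by
  rw [(mdifferentiableAt_slitProj u).mfderiv]
  have h : writtenInExtChartAt (𝓡 n).tangent (𝓡 n) u (slitProj n M) =ᶠ[𝓝 (extChartAt (𝓡 n).tangent u u)]
     (Prod.fst : Model n × Model n → Model n) := by
    filter_upwards [extChartAt_target_mem_nhds (I := (𝓡 n).tangent) u] with p hp
    have hq := (extChartAt (𝓡 n).tangent u).right_inv hp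
    exact congrArg Prod.fst hq
  have := h.fderiv_eq (𝕜 := ℝ)
  simp only [ModelWithCorners.range_eq_univ, fderivWithin_univ]
  erw [this, fderiv_fst]
  rfl

theorem coord_eq_sum (v : Model n) : v = ∑ j, v j • basisVec j := by
  ext i
  simp [basisVec, Finset.sum_apply, Pi.single_apply]

theorem coeffForm_apply (G) (c v : Model n) : coeffForm G c v = ∑ j, c j • ∑ i, (∑ k, G i j k * v k) • basisVec i := by
  ext a
  simp [coeffForm, basisVec, Pi.single_apply, Finset.mul_sum]
  refine Finset.sum_congr rfl fun j _ => Finset.sum_congr rfl fun k _ => by ring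

theorem mvfderiv_chart_comp (u : Slit n M) : mvfderiv (𝓡 n).tangent
            (fun u' : Slit n M => chartAt (Model n) (slitProj n M u) (slitProj n M u')) u
   = (mvfderiv (𝓡 n) (chartAt (Model n) (slitProj n M u)) (slitProj n M u)).comp (mfderiv (𝓡 n).tangent (𝓡 n) (slitProj n M) u) := by
  have h : MDifferentiableAt (𝓡 n) 𝓘(ℝ, Model n) (chartAt (Model n) (slitProj n M u)) (slitProj n M u) :=
    mdifferentiableAt_extChartAt (mem_chart_source _ _)
  exact mfderiv_comp u h (mdifferentiableAt_slitProj u)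

theorem mvfderiv_sectionCoord (u : Slit n M) (Y : Π x : M, TangentSpace (𝓡 n) x) (hY : MDifferentiableAt (𝓡 n) 𝓘(ℝ, Model n) (fun x => (trivializationAt (Model n) (TangentSpace (𝓡 n)) (slitProj n M u) ⟨x, Y x⟩).2) (slitProj n M u)) : mvfderiv (𝓡 n).tangent (sectionCoord u (pullbackField Y)) u
   = (mvfderiv (𝓡 n) (fun x => (trivializationAt (Model n) (TangentSpace (𝓡 n)) (slitProj n M u) ⟨x, Y x⟩).2) (slitProj n M u)).comp (mfderiv (𝓡 n).tangent (𝓡 n) (slitProj n M) u) :=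
  mfderiv_comp u hY (mdifferentiableAt_slitProj u)

theorem covariantDerivative_sum {D : (Π x : M, TangentSpace (𝓡 n) x) →
      (Π x : M, TangentSpace (𝓡 n) x →L[ℝ] TangentSpace (𝓡 n) x)} (hD : IsCovariantDerivativeOn (Model n) D Set.univ)
   {ι : Type} (s : Finset ι) (Z : ι → Π x : M, TangentSpace (𝓡 n) x) (x : M)
   (hZ : ∀ i, MDifferentiableAt (𝓡 n) (𝓡 n).tangent (fun x => (⟨x, Z i x⟩ : TangentBundle (𝓡 n) M)) x) :
   MDifferentiableAt (𝓡 n) (𝓡 n).tangent (fun x' => (⟨x', (∑ i ∈ s, Z i) x'⟩ : TangentBundle (𝓡 n) M)) x ∧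
   D (∑ i ∈ s, Z i) x = ∑ i ∈ s, D (Z i) x := by
  classical
  induction s using Finset.induction_on with
  | empty =>
    refine ⟨mdifferentiableAt_zeroSection ℝ _, ?_⟩
    simpa using hD.zero
  | insert i s hi ih =>
    rw [Finset.sum_insert hi, Finset.sum_insert hi]
    exact ⟨mdifferentiableAt_add_section (hZ i) ih.1, by rw [hD.add (hZ i) ih.1, ih.2]⟩

theorem mdifferentiableAt_coordField (x : M) (j : Fin n) :
  MDifferentiableAt (𝓡 n) (𝓡 n).tangent (fun x' => (⟨x', coordField (chartAt (Model n) x) j x'⟩ : TangentBundle (𝓡 n) M)) x := by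
  refine (mdifferentiableAt_section _ _).2 ?_
  refine (mdifferentiableAt_const (c := basisVec j)).congr_of_eventuallyEq ?_
  filter_upwards [(chartAt (Model n) x).open_source.mem_nhds (mem_chart_source _ x)] with x' hx'
  rw [coordField_chartAt hx']
  have h' : x' ∈ (trivializationAt (Model n) (TangentSpace (𝓡 n)) x).baseSet := hx'
  have := Trivialization.continuousLinearMapAt_symmL (R := ℝ) _ h' (basisVec j)
  rw [Trivialization.continuousLinearMapAt_apply, Trivialization.linearMapAt_apply, if_pos h'] at this
  exact this

theorem pullback_symmL (u : Slit n M) (w : Model n) :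
    (trivializationAt (Model n) (PullbackTangent n M) u).symmL ℝ u w
      = (trivializationAt (Model n) (TangentSpace (𝓡 n)) (slitProj n M u)).symmL ℝ (slitProj n M u) w := by
  have hb : slitProj n M u ∈ (trivializationAt (Model n) (TangentSpace (𝓡 n)) (slitProj n M u)).baseSet := mem_chart_source _ _
  have h0 := Trivialization.continuousLinearMapAt_symmL (R := ℝ) _ hb w
  rw [Trivialization.continuousLinearMapAt_apply, Trivialization.linearMapAt_apply, if_pos hb] at h0
  have h := symmL_sectionCoord u (pullbackField fun x =>
    (trivializationAt (Model n) (TangentSpace (𝓡 n)) (slitProj n M u)).symmL ℝ x w)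
  have h1 : sectionCoord u (pullbackField fun x =>
    (trivializationAt (Model n) (TangentSpace (𝓡 n)) (slitProj n M u)).symmL ℝ x w) u = w := h0
  rw [h1] at h
  exact h

/-- The defining property of the pull-back of a linear connection `D` on `M`:
`(π*D)_X π*Y = D_{dπ(X)} Y`, so `(π*D)_{ι(X)} π*Y = π*(D_X Y)` and `(π*D)_V π*Y = 0` for vertical `V`. -/
theorem pullbackConnection_pullbackField {D : (Π x : M, TangentSpace (𝓡 n) x) →
      (Π x : M, TangentSpace (𝓡 n) x →L[ℝ] TangentSpace (𝓡 n) x)} (hD : IsCovariantDerivativeOn (Model n) D Set.univ)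
   (Y : Π x : M, TangentSpace (𝓡 n) x) (u : Slit n M)
   (hY : MDifferentiableAt (𝓡 n) (𝓡 n).tangent (fun x => (⟨x, Y x⟩ : TangentBundle (𝓡 n) M)) (slitProj n M u))
   (X : TangentSpace (𝓡 n).tangent u) :
   pullbackConnection D (pullbackField Y) u X = D Y (slitProj n M u) (mfderiv (𝓡 n).tangent (𝓡 n) (slitProj n M) u X) := by
  set x := slitProj n M u with hx
  set φ := chartAt (Model n) x with hφ
  set e := trivializationAt (Model n) (TangentSpace (𝓡 n) : M → Type) x with he
  have hc : MDifferentiableAt (𝓡 n) 𝓘(ℝ, Model n) (fun x => (e ⟨x, Y x⟩).2) x := (mdifferentiableAt_section _ _).1 hY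
  set c : M → Model n := fun x => (e ⟨x, Y x⟩).2 with hcdef
  have hcj : ∀ j, MDifferentiableAt (𝓡 n) 𝓘(ℝ, ℝ) (fun x => c x j) x := fun j =>
     ((EuclideanSpace.proj j : Model n →L[ℝ] ℝ).differentiableAt.mdifferentiableAt).comp x hc
  have hxb : x ∈ e.baseSet := mem_chart_source _ x
  have hdY : D Y x = ∑ j, (c x j • D (coordField φ j) x + (mvfderiv (𝓡 n) (fun x => c x j) x).smulRight (coordField φ j x)) := by
    have hs := fun j => MDifferentiableAt.smul_section (hcj j) (mdifferentiableAt_coordField x j)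
    obtain ⟨h1, h2⟩ := covariantDerivative_sum hD Finset.univ (fun j => (fun x => c x j) • coordField φ j) x hs
    have h3 : D Y x = D (∑ j, (fun x => c x j) • coordField φ j) x := by
      refine hD.congr_of_eventuallyEq hY h1 Filter.univ_mem ?_
      filter_upwards [(chartAt (Model n) x).open_source.mem_nhds (mem_chart_source _ x)] with x' hx'
      have h' : x' ∈ e.baseSet := hx'
      rw [Finset.sum_apply]
      simp only [Pi.smul_apply']
      have : ∀ j, coordField φ j x' = _ := fun j => coordField_chartAt hx' j
      simp only [this]
      have h4 := Trivialization.symmL_continuousLinearMapAt (R := ℝ) e h' (Y x')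
      have h5 : e.continuousLinearMapAt ℝ x' (Y x') = c x' := by
        rw [Trivialization.continuousLinearMapAt_apply, Trivialization.linearMapAt_apply, if_pos h']
      rw [h5, coord_eq_sum (c x'), map_sum] at h4
      rw [← h4]
      exact Finset.sum_congr rfl fun j _ => ContinuousLinearMap.map_smul _ _ _
    rw [h3, h2]
    exact Finset.sum_congr rfl fun j _ => hD.leibniz (mdifferentiableAt_coordField x j) (hcj j)
  have hL : pullbackConnection D (pullbackField Y) u X = e.symmL ℝ x
     (mvfderiv (𝓡 n) c x (mfderiv (𝓡 n).tangent (𝓡 n) (slitProj n M) u X) + coeffForm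
      (fun i j k => component φ (D (coordField φ j) x (coordField φ k x)) i) (c x)
       (mvfderiv (𝓡 n) φ x (mfderiv (𝓡 n).tangent (𝓡 n) (slitProj n M) u X))) := by
    have h1 := congrArg (fun A => A X) (mvfderiv_sectionCoord u Y hc)
    have h2 := congrArg (fun A => A X) (mvfderiv_chart_comp u)
    simp only [ContinuousLinearMap.comp_apply] at h1 h2
    refine Eq.trans (pullback_symmL u _) ?_
    exact congrArg (e.symmL ℝ x) (congrArg₂ (fun a b : Model n => a + coeffForm
      (fun i j k => component φ (D (coordField φ j) x (coordField φ k x)) i) (c x) b) h1 h2)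
  set Z := mfderiv (𝓡 n).tangent (𝓡 n) (slitProj n M) u X with hZ
  have hinv : ∀ W : TangentSpace (𝓡 n) x, e.symmL ℝ x (mvfderiv (𝓡 n) φ x W) = W := fun W => by
    rw [← continuousLinearMapAt_eq_mvfderiv (mem_chart_source _ x)]
    exact Trivialization.symmL_continuousLinearMapAt e hxb W
  have hframe : ∀ j, e.symmL ℝ x (basisVec j) = coordField φ j x := fun j => (coordField_chartAt (mem_chart_source _ x) j).symm
  have hZs : Z = ∑ k, (mvfderiv (𝓡 n) φ x Z) k • coordField φ k x := by
    conv_lhs => rw [← hinv Z, coord_eq_sum (mvfderiv (𝓡 n) φ x Z), map_sum]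
    exact Finset.sum_congr rfl fun j _ => by rw [← hframe]; exact ContinuousLinearMap.map_smul _ _ _
  have hdc : ∀ j, mvfderiv (𝓡 n) (fun x => c x j) x Z = (mvfderiv (𝓡 n) c x Z) j := fun j => by
    have := mfderiv_comp x ((EuclideanSpace.proj j : Model n →L[ℝ] ℝ).differentiableAt (x := c x)).mdifferentiableAt hc
    have h2 := congrArg (fun A => A Z) this
    rw [ContinuousLinearMap.mfderiv_eq] at h2
    exact h2
  have hco : ∀ j, ∑ i, (∑ k, component φ (D (coordField φ j) x (coordField φ k x)) i * (mvfderiv (𝓡 n) φ x Z) k) • basisVec i = mvfderiv (𝓡 n) φ x (D (coordField φ j) x Z) := by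
    intro j
    conv_rhs => rw [hZs, map_sum, map_sum, coord_eq_sum (∑ k, _)]
    refine Finset.sum_congr rfl fun i _ => ?_
    congr 1
    rw [WithLp.ofLp_sum, Finset.sum_apply]
    refine Finset.sum_congr rfl fun k _ => ?_
    rw [ContinuousLinearMap.map_smul, ContinuousLinearMap.map_smul]
    exact mul_comm _ _
  rw [hL, coeffForm_apply, hdY]
  simp only [hco]
  rw [map_add, map_sum, coord_eq_sum (mvfderiv (𝓡 n) c x Z), map_sum]
  rw [_root_.sum_apply, ← Finset.sum_add_distrib]
  refine Finset.sum_congr rfl fun j _ => ?_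
  have e1 := (e.symmL ℝ x).map_smul ((mvfderiv (𝓡 n) c x Z) j) (basisVec j)
  have e2 := (e.symmL ℝ x).map_smul (c x j) (mvfderiv (𝓡 n) φ x (D (coordField φ j) x Z))
  rw [hinv] at e2
  rw [hframe] at e1
  rw [e1, e2]
  simp [hdc]
  abel
/-- `dπ(ι_u(X)) = X`. -/
theorem mfderiv_slitProj_horizontalLift (F : FinslerStructure n M) (u : Slit n M)
    (X : TangentSpace (𝓡 n) (slitProj n M u)) :
    mfderiv (𝓡 n).tangent (𝓡 n) (slitProj n M) u (F.horizontalLift u X) = X :=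
  mfderiv_slitProj u _

end Manifold

end Finsler

end

open Bundle MeasureTheory Filter Topology
open scoped Manifold ContDiff

noncomputable section

/-! Both the Chern connection and the pull-back of an operator on vector fields are of the form
`connectionOfCoeff G`: their connection forms in preferred charts have no `dy`-terms. On a
pulled-back field `π*Y`, with `Y` differentiable, such a connection depends on the point `u` over
`x` only through `G u`, and on the direction only through `dπ`. Since `dπ ∘ ι_u` is the identity of
`T_xM`, the derivative along `ι_u(X)` depends on `y` through `G u` alone
(`connectionOfCoeff_horizontalLift_congr`).

If the Chern coefficients do not depend on `y`, the integrand defining the average of a coordinate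
field is constant on `I_x`. Its mean is that constant, so the averaged coefficients are the Chern
coefficients. Conversely, the coefficients of a pull-back depend only on `x`. If the pull-back of
the average is the Chern connection, evaluation on the coordinate fields of an arbitrary chart gives
coefficients independent of `y`.

The analytic input is that `vol(I_x)` is positive and finite; otherwise the mean of a constant need
not be that constant. The density `√det g` and the quotient `F/‖y‖` are continuous, positive and of
degree zero on `T_xM \ 0`, hence controlled by their extrema on the unit sphere. -/

namespace Finsler

/-! ### Covariant derivatives of pulled-back fields and connection coefficients -/

section Connection

variable {n : ℕ} {M : Type*} [TopologicalSpace M] [ChartedSpace (Model n) M]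
  [IsManifold (𝓡 n) ∞ M]

/-- The value of a connection with coefficients `G` on the pull-back of a vector field depends on
the point of the slit tangent bundle only through `G`, and on the direction only through `dπ`. -/
theorem connectionOfCoeff_pullbackField (G : Slit n M → Fin n → Fin n → Fin n → ℝ)
    (Y : Π x : M, TangentSpace (𝓡 n) x) (u : Slit n M)
    (hY : MDifferentiableAt (𝓡 n) (𝓡 n).tangent
      (fun x => (⟨x, Y x⟩ : TangentBundle (𝓡 n) M)) (slitProj n M u))
    (X : TangentSpace (𝓡 n).tangent u) {Z : TangentSpace (𝓡 n) (slitProj n M u)}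
    (hX : mfderiv (𝓡 n).tangent (𝓡 n) (slitProj n M) u X = Z) :
    connectionOfCoeff G (pullbackField Y) u X =
      (trivializationAt (Model n) (TangentSpace (𝓡 n)) (slitProj n M u)).symmL ℝ (slitProj n M u)
        (mvfderiv (𝓡 n) (fun x => (trivializationAt (Model n) (TangentSpace (𝓡 n))
            (slitProj n M u) ⟨x, Y x⟩).2) (slitProj n M u)
            Z
          + coeffForm (G u) (trivializationAt (Model n) (TangentSpace (𝓡 n))
            (slitProj n M u) ⟨slitProj n M u, Y (slitProj n M u)⟩).2
            (mvfderiv (𝓡 n) (chartAt (Model n) (slitProj n M u)) (slitProj n M u)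
              Z)) := by
  -- The direction enters only through `Z`, so a horizontal lift can later be replaced by a vector
  -- of `T_xM` in which `y` does not occur.
  subst hX
  have hc := (mdifferentiableAt_section _ Y).1 hY
  have h1 := congrArg (fun A => A X) (mvfderiv_sectionCoord u Y hc)
  have h2 := congrArg (fun A => A X) (mvfderiv_chart_comp u)
  simp only [ContinuousLinearMap.comp_apply] at h1 h2
  refine Eq.trans (pullback_symmL u _) ?_
  exact congrArg
    ((trivializationAt (Model n) (TangentSpace (𝓡 n)) (slitProj n M u)).symmL ℝ (slitProj n M u))
    (congrArg₂ (fun a b : Model n => a + coeffForm (G u) (trivializationAt (Model n)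
      (TangentSpace (𝓡 n)) (slitProj n M u) ⟨slitProj n M u, Y (slitProj n M u)⟩).2 b) h1 h2)

/-- The coefficients of a connection determine the covariant derivative of a pull-back along the
horizontal lift. -/
theorem FinslerStructure.connectionOfCoeff_horizontalLift_congr (F : FinslerStructure n M)
    (G : Slit n M → Fin n → Fin n → Fin n → ℝ) (Y : Π x : M, TangentSpace (𝓡 n) x) (x : M)
    (hY : MDifferentiableAt (𝓡 n) (𝓡 n).tangent
      (fun x => (⟨x, Y x⟩ : TangentBundle (𝓡 n) M)) x)
    (y y' : TangentSpace (𝓡 n) x) (hy : y ≠ 0) (hy' : y' ≠ 0)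
    (hG : G (slitPoint x y hy) = G (slitPoint x y' hy')) (X : TangentSpace (𝓡 n) x) :
    (connectionOfCoeff G (pullbackField Y) (slitPoint x y hy)
      (F.horizontalLift (slitPoint x y hy) X) : TangentSpace (𝓡 n) x)
      = connectionOfCoeff G (pullbackField Y) (slitPoint x y' hy')
        (F.horizontalLift (slitPoint x y' hy') X) := by
  refine (connectionOfCoeff_pullbackField G Y (slitPoint x y hy) hY _
    (mfderiv_slitProj_horizontalLift F (slitPoint x y hy) X)).trans (Eq.trans ?_
      (connectionOfCoeff_pullbackField G Y (slitPoint x y' hy') hY _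
        (mfderiv_slitProj_horizontalLift F (slitPoint x y' hy') X)).symm)
  -- With `dπ(ι_u(X)) = X` on both sides, the two expressions differ only in the coefficients.
  exact congrArg (fun g => (trivializationAt (Model n) (TangentSpace (𝓡 n)) x).symmL ℝ x
    (mvfderiv (𝓡 n) (fun x' => (trivializationAt (Model n) (TangentSpace (𝓡 n))
        x ⟨x', Y x'⟩).2) x X
      + coeffForm g (trivializationAt (Model n) (TangentSpace (𝓡 n)) x ⟨x, Y x⟩).2
        (mvfderiv (𝓡 n) (chartAt (Model n) x) x X))) hG

/-- The coordinate vector fields of a chart of the maximal atlas are differentiable. -/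
theorem mdifferentiableAt_coordField_of_mem_maximalAtlas
    {φ : OpenPartialHomeomorph M (Model n)} (hφ : φ ∈ IsManifold.maximalAtlas (𝓡 n) ∞ M)
    {x : M} (hx : x ∈ φ.source) (j : Fin n) :
    MDifferentiableAt (𝓡 n) (𝓡 n).tangent
      (fun x' => (⟨x', coordField φ j x'⟩ : TangentBundle (𝓡 n) M)) x := by
  have hs : ContMDiffAt (𝓡 n) (𝓡 n) ∞ φ x := contMDiffAt_of_mem_maximalAtlas hφ hx
  have hd : φ.MDifferentiable (𝓡 n) (𝓡 n) :=
    ⟨(contMDiffOn_of_mem_maximalAtlas hφ).mdifferentiableOn (by simp),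
      (contMDiffOn_symm_of_mem_maximalAtlas hφ).mdifferentiableOn (by simp)⟩
  have hV : MDifferentiableAt (𝓡 n) (𝓡 n).tangent
      (fun p : Model n => (⟨p, basisVec j⟩ : TangentBundle (𝓡 n) (Model n))) (φ x) := by
    refine (mdifferentiableAt_section _ _).2 ?_
    simp only [trivializationAt_model_space_apply]
    exact mdifferentiableAt_const
  -- The field `∂/∂xʲ` is the pull-back along `φ` of a constant field of `ℝⁿ`; the differential of
  -- `φ` is invertible at `x`.
  exact MDifferentiableAt.mpullback_vectorField
    (V := fun _ : Model n => (basisVec j : Model n)) hV hs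
    ⟨hd.mfderiv hx, rfl⟩ (by norm_cast)

theorem mvfderiv_symmL_self (x : M) (w : Model n) :
    mvfderiv (𝓡 n) (chartAt (Model n) x) x
      ((trivializationAt (Model n) (TangentSpace (𝓡 n)) x).symmL ℝ x w) = w := by
  rw [← continuousLinearMapAt_eq_mvfderiv (mem_chart_source _ x)]
  exact Trivialization.continuousLinearMapAt_symmL _ (mem_chart_source _ x) w

theorem coeffForm_basisVec (G : Fin n → Fin n → Fin n → ℝ) (i j k : Fin n) :
    coeffForm G (basisVec j) (basisVec k) i = G i j k := by
  simp [coeffForm_apply, basisVec, Pi.single_apply]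

/-- The coefficients of a connection in the preferred chart. -/
theorem component_connectionOfCoeff (G : Slit n M → Fin n → Fin n → Fin n → ℝ) (u : Slit n M)
    (i j k : Fin n) (X : TangentSpace (𝓡 n).tangent u)
    (hX : mfderiv (𝓡 n).tangent (𝓡 n) (slitProj n M) u X
      = coordField (chartAt (Model n) (slitProj n M u)) k (slitProj n M u)) :
    component (chartAt (Model n) (slitProj n M u)) (x := slitProj n M u)
      (connectionOfCoeff G
        (pullbackField (coordField (chartAt (Model n) (slitProj n M u)) j)) u X) i
      = G u i j k := by
  -- In the trivialization at the base point, `∂/∂xʲ` of the preferred chart is constant. Its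
  -- derivative term therefore vanishes and only the coefficient term survives.
  have hev : ∀ᶠ x in 𝓝 (slitProj n M u), (trivializationAt (Model n) (TangentSpace (𝓡 n))
      (slitProj n M u) ⟨x, coordField (chartAt (Model n) (slitProj n M u)) j x⟩).2
        = basisVec j := by
    filter_upwards [(chartAt (Model n) (slitProj n M u)).open_source.mem_nhds
      (mem_chart_source _ _)] with x' hx'
    rw [coordField_chartAt hx']
    have h' : x' ∈ (trivializationAt (Model n) (TangentSpace (𝓡 n)) (slitProj n M u)).baseSet :=
      hx'
    have := Trivialization.continuousLinearMapAt_symmL (R := ℝ) _ h' (basisVec j)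
    rw [Trivialization.continuousLinearMapAt_apply, Trivialization.linearMapAt_apply,
      if_pos h'] at this
    exact this
  have hd : mvfderiv (𝓡 n) (fun x => (trivializationAt (Model n) (TangentSpace (𝓡 n))
      (slitProj n M u) ⟨x, coordField (chartAt (Model n) (slitProj n M u)) j x⟩).2)
        (slitProj n M u) = 0 := by
    have h : (fun x => (trivializationAt (Model n) (TangentSpace (𝓡 n))
      (slitProj n M u) ⟨x, coordField (chartAt (Model n) (slitProj n M u)) j x⟩).2)
        =ᶠ[𝓝 (slitProj n M u)] fun _ => basisVec j := hev
    have h2 := h.mfderiv_eq (I := 𝓡 n) (I' := 𝓘(ℝ, Model n))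
    rw [mfderiv_const] at h2
    ext1 v
    exact congrArg (fun A => A v) h2
  unfold component
  rw [connectionOfCoeff_pullbackField G _ u (mdifferentiableAt_coordField _ j) X hX,
    mvfderiv_symmL_self, hd, hev.self_of_nhds, coordField_chartAt (mem_chart_source _ _) k,
    mvfderiv_symmL_self]
  simp [coeffForm_basisVec]

/-- The coefficients, in the natural coordinates of any chart, of a connection whose coefficients in
the preferred chart do not depend on `y`, do not depend on `y` either. -/
theorem FinslerStructure.connectionCoeff_slitPoint_eq (F : FinslerStructure n M)
    (G : Slit n M → Fin n → Fin n → Fin n → ℝ) {φ : OpenPartialHomeomorph M (Model n)}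
    (hφ : φ ∈ IsManifold.maximalAtlas (𝓡 n) ∞ M) {x : M} (hx : x ∈ φ.source)
    (y y' : TangentSpace (𝓡 n) x) (hy : y ≠ 0) (hy' : y' ≠ 0)
    (hG : G (slitPoint x y hy) = G (slitPoint x y' hy')) (i j k : Fin n) :
    F.connectionCoeff (connectionOfCoeff G) φ (slitPoint x y hy) i j k
      = F.connectionCoeff (connectionOfCoeff G) φ (slitPoint x y' hy') i j k := by
  exact congrArg (fun v => component φ (x := x) v i)
    (F.connectionOfCoeff_horizontalLift_congr G _ x
      (mdifferentiableAt_coordField_of_mem_maximalAtlas hφ hx j) y y' hy hy' hG _)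

end Connection

/-! ### Homogeneous functions and iterated directional derivatives -/

section LineDeriv

variable {E : Type*} [NormedAddCommGroup E] [NormedSpace ℝ E]

/-- The directional derivative of a homogeneous function is homogeneous. -/
theorem lineDeriv_smul_of_homogeneous {h : E → ℝ} {a c : ℝ} (hc : c ≠ 0)
    (hh : ∀ z, h (c • z) = a * h z) (y w : E) :
    lineDeriv ℝ h (c • y) w = a * c⁻¹ * lineDeriv ℝ h y w := by
  have he : (fun t : ℝ => h (c • y + t • w)) = fun t => a * (fun s : ℝ => h (y + s • w)) (c⁻¹ * t) := by
    funext t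
    have hz : c • y + t • w = c • (y + (c⁻¹ * t) • w) := by
      rw [smul_add, smul_smul, mul_inv_cancel_left₀ hc]
    simp only [hz, hh]
  rw [lineDeriv, he, deriv_const_mul_field]
  rw [deriv_comp_mul_left (f := fun s : ℝ => h (y + s • w))]
  simp only [mul_zero, smul_eq_mul, lineDeriv]
  ring

/-- Iterated directional derivatives are given by the second derivative. -/
theorem lineDeriv_lineDeriv_eq {h : E → ℝ} {s : Set E} (hs : IsOpen s) (hh : ContDiffOn ℝ 2 h s)
    {y : E} (hy : y ∈ s) (v w : E) :
    lineDeriv ℝ (fun y' => lineDeriv ℝ h y' w) y v = fderiv ℝ (fderiv ℝ h) y v w := by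
  have hd : DifferentiableAt ℝ (fderiv ℝ h) y :=
    ((hh.fderiv_of_isOpen (m := 1) hs (by norm_num)).differentiableOn
      (by norm_num)).differentiableAt (hs.mem_nhds hy)
  -- The inner derivatives must agree near `y`, not only at `y`, because they are differentiated
  -- once more.
  have he : (fun y' => lineDeriv ℝ h y' w) =ᶠ[𝓝 y] fun y' => fderiv ℝ h y' w := by
    filter_upwards [hs.mem_nhds hy] with z hz
    exact ((hh.differentiableOn (by norm_num)).differentiableAt
      (hs.mem_nhds hz)).lineDeriv_eq_fderiv
  have hd' : DifferentiableAt ℝ (fun y' => fderiv ℝ h y' w) y :=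
    hd.clm_apply (differentiableAt_const w)
  rw [he.lineDeriv_eq, hd'.lineDeriv_eq_fderiv, fderiv_clm_apply hd (differentiableAt_const w)]
  simp

/-- A continuous positive function that is invariant under positive scaling has positive lower and
upper bounds. -/
theorem exists_bounds_of_homogeneous_zero [FiniteDimensional ℝ E] [Nontrivial E] {h : E → ℝ}
    (hc : ContinuousOn h {0}ᶜ) (hpos : ∀ y, y ≠ 0 → 0 < h y)
    (hh : ∀ c : ℝ, 0 < c → ∀ y, y ≠ 0 → h (c • y) = h y) :
    ∃ a b : ℝ, 0 < a ∧ ∀ y, y ≠ 0 → a ≤ h y ∧ h y ≤ b := by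
  have hK : IsCompact (Metric.sphere (0 : E) 1) := isCompact_sphere 0 1
  have hne : (Metric.sphere (0 : E) 1).Nonempty := NormedSpace.sphere_nonempty.2 zero_le_one
  have h0 : ∀ y ∈ Metric.sphere (0 : E) 1, y ≠ 0 := fun y hy => ne_zero_of_mem_unit_sphere ⟨y, hy⟩
  have hcK : ContinuousOn h (Metric.sphere (0 : E) 1) := hc.mono fun y hy => h0 y hy
  obtain ⟨p, hp, hmin⟩ := hK.exists_isMinOn hne hcK
  obtain ⟨q, hq, hmax⟩ := hK.exists_isMaxOn hne hcK
  refine ⟨h p, h q, hpos p (h0 p hp), fun y hy => ?_⟩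
  have hn : 0 < ‖y‖⁻¹ := inv_pos.2 (norm_pos_iff.2 hy)
  have hy1 : ‖y‖⁻¹ • y ∈ Metric.sphere (0 : E) 1 := by
    rw [mem_sphere_zero_iff_norm, norm_smul, norm_inv, norm_norm,
      inv_mul_cancel₀ (norm_ne_zero_iff.2 hy)]
  rw [← hh _ hn y hy]
  exact ⟨hmin hy1, hmax hy1⟩

end LineDeriv

/-! ### Positivity and finiteness of the volume of the indicatrix -/

section FiberVolume

variable {n : ℕ} {M : Type*} [TopologicalSpace M] [ChartedSpace (Model n) M]
  [IsManifold (𝓡 n) ∞ M]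

/-- The inclusion of a tangent space into the tangent bundle is smooth. -/
theorem contMDiff_tangentSpace_mk (x : M) :
    ContMDiff 𝓘(ℝ, Model n) (𝓡 n).tangent ∞
      (fun z : Model n => (⟨x, z⟩ : TangentBundle (𝓡 n) M)) := by
  intro z
  -- The base component is constant, and the fibre component is linear in `z` in the trivialization
  -- at `x`.
  refine contMDiffAt_totalSpace.2 ⟨contMDiffAt_const, ?_⟩
  have h : (fun z : Model n => (trivializationAt (Model n) (TangentSpace (𝓡 n) : M → Type) x
      ⟨x, z⟩).2) = fun z : Model n => ((trivializationAt (Model n)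
        (TangentSpace (𝓡 n) : M → Type) x).continuousLinearMapAt ℝ x : Model n →L[ℝ] Model n) z := by
    have hx : x ∈ (trivializationAt (Model n) (TangentSpace (𝓡 n) : M → Type) x).baseSet :=
      FiberBundle.mem_baseSet_trivializationAt' x
    have key : ∀ z : TangentSpace (𝓡 n) x,
        (trivializationAt (Model n) (TangentSpace (𝓡 n) : M → Type) x ⟨x, z⟩).2
          = (trivializationAt (Model n)
            (TangentSpace (𝓡 n) : M → Type) x).continuousLinearMapAt ℝ x z := fun z => by
      rw [Trivialization.continuousLinearMapAt_apply, Trivialization.linearMapAt_apply, if_pos hx]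
    exact funext key
  refine ContMDiffAt.congr_of_eventuallyEq ?_ (Eventually.of_forall (congrFun h))
  exact (ContinuousLinearMap.contDiff _).contMDiff.contMDiffAt

namespace FinslerStructure

variable (F : FinslerStructure n M) (x : M)

theorem contDiffOn_fiber : ContDiffOn ℝ ∞ (fun z : Model n => F.toFun ⟨x, z⟩) {0}ᶜ := by
  rw [← contMDiffOn_iff_contDiffOn]
  exact F.smooth.comp (contMDiff_tangentSpace_mk x).contMDiffOn fun z hz => hz

theorem contDiffOn_fiber_sq : ContDiffOn ℝ 2 (fun z : Model n => F.toFun ⟨x, z⟩ ^ 2) {0}ᶜ :=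
  ((F.contDiffOn_fiber x).pow 2).of_le (by norm_cast)

/-- The Gram matrix `g_{ij}(x, y)` of the fundamental tensor. -/
def fiberMetric (y : Model n) : Matrix (Fin n) (Fin n) ℝ :=
  Matrix.of fun i j => fundamentalTensor F.toFun x y (basisVec i) (basisVec j)

/-- The definition by directional derivatives is not visibly bilinear. Away from the origin `F²` is
of class C², so it is half of a genuine second derivative. -/
theorem fundamentalTensor_eq_fderiv {y : Model n} (hy : y ≠ 0) (v w : Model n) :
    fundamentalTensor F.toFun x y v w
      = (1 / 2) * fderiv ℝ (fderiv ℝ fun z : Model n => F.toFun ⟨x, z⟩ ^ 2) y v w :=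
  congrArg (fun a : ℝ => (1 / 2) * a)
    (lineDeriv_lineDeriv_eq isOpen_compl_singleton (F.contDiffOn_fiber_sq x) hy v w)

theorem fiberMetric_apply {y : Model n} (hy : y ≠ 0) (i j : Fin n) :
    F.fiberMetric x y i j = (1 / 2) * fderiv ℝ (fderiv ℝ fun z : Model n => F.toFun ⟨x, z⟩ ^ 2) y
      (basisVec i) (basisVec j) :=
  F.fundamentalTensor_eq_fderiv x hy _ _

/-- `F²` has degree two in `y`, and each of the two derivatives lowers the degree by one. -/
theorem fiberMetric_smul {c : ℝ} (hc : 0 < c) (y : Model n) :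
    F.fiberMetric x (c • y) = F.fiberMetric x y := by
  ext i j
  have h0 : ∀ z : Model n, F.toFun ⟨x, c • z⟩ ^ 2 = c ^ 2 * F.toFun ⟨x, z⟩ ^ 2 := fun z => by
    rw [← mul_pow]
    exact congrArg (· ^ 2) (F.homogeneous x z c hc)
  have h1 := lineDeriv_smul_of_homogeneous
    (h := fun z => lineDeriv ℝ (fun z : Model n => F.toFun ⟨x, z⟩ ^ 2) z (basisVec j)) hc.ne'
    (fun z => lineDeriv_smul_of_homogeneous hc.ne' h0 z (basisVec j)) y (basisVec i)
  have h2 : c ^ 2 * c⁻¹ * c⁻¹ = 1 := by field_simp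
  rw [h2, one_mul] at h1
  exact congrArg (fun a : ℝ => (1 / 2) * a) h1

/-- Symmetry is Schwarz's theorem for `F²`. Positivity is strong convexity, carried over to the
matrix by expanding `v` in the canonical basis. -/
theorem posDef_fiberMetric {y : Model n} (hy : y ≠ 0) : (F.fiberMetric x y).PosDef := by
  refine Matrix.PosDef.of_dotProduct_mulVec_pos ?_ fun v hv => ?_
  · ext i j
    have hsymm : IsSymmSndFDerivAt ℝ (fun z : Model n => F.toFun ⟨x, z⟩ ^ 2) y :=
      ((F.contDiffOn_fiber_sq x).contDiffAt
        (isOpen_compl_singleton.mem_nhds hy)).isSymmSndFDerivAt (by simp)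
    rw [Matrix.conjTranspose_apply, fiberMetric_apply F x hy, fiberMetric_apply F x hy, hsymm]
    simp
  · have hw : WithLp.toLp 2 v ≠ (0 : Model n) := fun h => hv (congrArg WithLp.ofLp h)
    have h := F.stronglyConvex x y (WithLp.toLp 2 v) hy hw
    have h2 : fundamentalTensor F.toFun x y (WithLp.toLp 2 v : Model n) (WithLp.toLp 2 v : Model n)
        = star v ⬝ᵥ (F.fiberMetric x y).mulVec v := by
      rw [F.fundamentalTensor_eq_fderiv x hy, coord_eq_sum (WithLp.toLp 2 v)]
      simp only [map_sum, map_smul, _root_.sum_apply, _root_.smul_apply, smul_eq_mul, dotProduct,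
        Matrix.mulVec, Finset.mul_sum, fiberMetric_apply F x hy]
      refine Finset.sum_comm.trans ?_
      refine Finset.sum_congr rfl fun i _ => Finset.sum_congr rfl fun j _ => ?_
      simp
      ring
    exact h2 ▸ h

theorem continuousOn_det_fiberMetric :
    ContinuousOn (fun y => (F.fiberMetric x y).det) {0}ᶜ := by
  have h1 : ContinuousOn (fderiv ℝ (fderiv ℝ fun z : Model n => F.toFun ⟨x, z⟩ ^ 2)) {0}ᶜ :=
    ((F.contDiffOn_fiber_sq x).fderiv_of_isOpen (m := 1) isOpen_compl_singleton
      (by norm_num)).continuousOn_fderiv_of_isOpen isOpen_compl_singleton (by norm_num)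
  have h2 : ContinuousOn (F.fiberMetric x) {0}ᶜ := by
    refine continuousOn_pi.2 fun i => continuousOn_pi.2 fun j => ?_
    refine ContinuousOn.congr (f := fun y => (1 / 2) * fderiv ℝ (fderiv ℝ fun z : Model n =>
      F.toFun ⟨x, z⟩ ^ 2) y (basisVec i) (basisVec j)) ?_
      fun y hy => F.fiberMetric_apply x hy i j
    exact continuousOn_const.mul ((h1.clm_apply continuousOn_const).clm_apply continuousOn_const)
  exact (Continuous.matrix_det continuous_id).comp_continuousOn h2

/-- The density of the Riemannian volume of `T_xM \ 0` is bounded above and away from zero. -/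
theorem exists_bounds_sqrt_det [Nontrivial (Model n)] :
    ∃ a b : ℝ, 0 < a ∧ ∀ y : Model n, y ≠ 0 →
      a ≤ Real.sqrt (F.fiberMetric x y).det ∧ Real.sqrt (F.fiberMetric x y).det ≤ b :=
  exists_bounds_of_homogeneous_zero (F.continuousOn_det_fiberMetric x).sqrt
    (fun _ hy => Real.sqrt_pos.2 (F.posDef_fiberMetric x hy).det_pos)
    fun c hc y _ => by rw [F.fiberMetric_smul x hc]

/-- A Finsler function dominates a multiple of the norm. -/
theorem exists_mul_norm_le [Nontrivial (Model n)] :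
    ∃ a : ℝ, 0 < a ∧ ∀ y : Model n, a * ‖y‖ ≤ F.toFun ⟨x, y⟩ := by
  -- The quotient `F/‖y‖` has degree zero, and its lower bound is the required constant.
  obtain ⟨a, b, ha, hab⟩ := exists_bounds_of_homogeneous_zero
    (h := fun y : Model n => F.toFun ⟨x, y⟩ / ‖y‖)
    ((F.contDiffOn_fiber x).continuousOn.div continuous_norm.continuousOn
      fun y hy => norm_ne_zero_iff.2 hy)
    (fun y hy => div_pos (F.pos x y hy) (norm_pos_iff.2 hy))
    (fun c hc y hy => by
      have h : F.toFun ⟨x, c • y⟩ = c * F.toFun ⟨x, y⟩ := F.homogeneous x y c hc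
      change F.toFun ⟨x, c • y⟩ / ‖c • y‖ = F.toFun ⟨x, y⟩ / ‖y‖
      rw [h, norm_smul, Real.norm_of_nonneg hc.le, mul_div_mul_left _ _ hc.ne'])
  refine ⟨a, ha, fun y => ?_⟩
  rcases eq_or_ne y 0 with rfl | hy
  · simpa using F.nonneg _
  · exact (le_div_iff₀ (norm_pos_iff.2 hy)).1 (hab y hy).1

theorem continuous_radialProj : Continuous (F.radialProj x) := by
  have h : Continuous fun y : {y : Model n // y ≠ 0} => F.toFun ⟨x, (y : Model n)⟩ :=
    (F.contDiffOn_fiber x).continuousOn.comp_continuous continuous_subtype_val fun y => y.2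
  exact Continuous.subtype_mk
    ((h.inv₀ fun y => (F.pos x y.1 y.2).ne').smul continuous_subtype_val) _

/-- The origin is removed because `F` is assumed smooth only on non-zero vectors. -/
theorem isOpen_fiber_ball : IsOpen {y : Model n | y ≠ 0 ∧ F.toFun ⟨x, y⟩ < 1} :=
  (F.contDiffOn_fiber x).continuousOn.isOpen_inter_preimage isOpen_compl_singleton isOpen_Iio

/-- Every non-zero vector projects radially to the indicatrix, so the cone over all of `I_x` is the
punctured unit ball of `F`. -/
theorem indicatrixVolume_univ : F.indicatrixVolume x Set.univ
    = n * F.fiberVolume x {y : Model n | y ≠ 0 ∧ F.toFun ⟨x, y⟩ < 1} := by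
  have hm : MeasurableSet {y : Model n | y ≠ 0} := isOpen_compl_singleton.measurableSet
  rw [indicatrixVolume, Measure.smul_apply, smul_eq_mul,
    Measure.map_apply (F.continuous_radialProj x).measurable MeasurableSet.univ,
    Set.preimage_univ]
  refine congrArg ((n : ENNReal) * ·)
    (((MeasurableEmbedding.subtype_coe hm).comap_apply _ _).trans ?_)
  rw [Set.image_univ, Subtype.range_coe_subtype]
  exact Measure.restrict_apply hm

theorem fiberVolume_fiber_ball : F.fiberVolume x {y : Model n | y ≠ 0 ∧ F.toFun ⟨x, y⟩ < 1}
    = ∫⁻ y in {y : Model n | y ≠ 0 ∧ F.toFun ⟨x, y⟩ < 1},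
      ENNReal.ofReal (Real.sqrt (F.fiberMetric x y).det) :=
  withDensity_apply' _ _

/-- The density is bounded above, and `m‖y‖ ≤ F(x, y)` places the ball of `F` inside a Euclidean
ball of radius `1/m`. -/
theorem fiberVolume_fiber_ball_lt_top [Nontrivial (Model n)] :
    F.fiberVolume x {y : Model n | y ≠ 0 ∧ F.toFun ⟨x, y⟩ < 1} < ⊤ := by
  obtain ⟨a, b, -, hab⟩ := F.exists_bounds_sqrt_det x
  obtain ⟨m, hm, hle⟩ := F.exists_mul_norm_le x
  have hv : volume {y : Model n | y ≠ 0 ∧ F.toFun ⟨x, y⟩ < 1} < ⊤ := by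
    refine (measure_mono fun y hy => ?_).trans_lt
      (measure_closedBall_lt_top (x := (0 : Model n)) (r := m⁻¹))
    rw [mem_closedBall_zero_iff, ← mul_le_mul_iff_right₀ hm, mul_inv_cancel₀ hm.ne']
    exact (hle y).trans hy.2.le
  rw [fiberVolume_fiber_ball]
  refine (setLIntegral_mono' (F.isOpen_fiber_ball x).measurableSet
    fun y hy => ENNReal.ofReal_le_ofReal (hab y hy.1).2).trans_lt ?_
  rw [setLIntegral_const]
  exact ENNReal.mul_lt_top ENNReal.ofReal_lt_top hv

/-- A non-empty open set has positive Lebesgue measure, and the density is bounded below by a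
positive constant. -/
theorem fiberVolume_fiber_ball_pos [Nontrivial (Model n)] :
    0 < F.fiberVolume x {y : Model n | y ≠ 0 ∧ F.toFun ⟨x, y⟩ < 1} := by
  obtain ⟨a, b, ha, hab⟩ := F.exists_bounds_sqrt_det x
  have hne : {y : Model n | y ≠ 0 ∧ F.toFun ⟨x, y⟩ < 1}.Nonempty := by
    obtain ⟨y, hy⟩ := exists_ne (0 : Model n)
    have hp : 0 < F.toFun ⟨x, y⟩ := F.pos x y hy
    have hc : 0 < (2 * F.toFun ⟨x, y⟩)⁻¹ := by positivity
    -- The rescaled vector has `F = 1/2`.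
    refine ⟨(2 * F.toFun ⟨x, y⟩)⁻¹ • y, smul_ne_zero hc.ne' hy, ?_⟩
    have h : F.toFun ⟨x, (2 * F.toFun ⟨x, y⟩)⁻¹ • y⟩ = _ := F.homogeneous x y _ hc
    rw [h]
    field_simp
    norm_num
  rw [fiberVolume_fiber_ball]
  refine lt_of_lt_of_le ?_ (setLIntegral_mono' (F.isOpen_fiber_ball x).measurableSet
    fun y hy => ENNReal.ofReal_le_ofReal (hab y hy.1).1)
  rw [setLIntegral_const]
  exact ENNReal.mul_pos (ENNReal.ofReal_pos.2 ha).ne'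
    ((F.isOpen_fiber_ball x).measure_pos volume hne).ne'

/-- The volume of the indicatrix is finite. -/
theorem isFiniteMeasure_indicatrixVolume [Nontrivial (Model n)] :
    IsFiniteMeasure (F.indicatrixVolume x) :=
  ⟨by
    rw [indicatrixVolume_univ]
    exact ENNReal.mul_lt_top (ENNReal.natCast_lt_top n) (F.fiberVolume_fiber_ball_lt_top x)⟩

/-- The volume of the indicatrix is positive. -/
theorem neZero_indicatrixVolume [Nontrivial (Model n)] (hn : n ≠ 0) :
    NeZero (F.indicatrixVolume x) := by
  refine ⟨fun h => ?_⟩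
  have h1 := F.indicatrixVolume_univ x
  rw [h, Measure.coe_zero, Pi.zero_apply] at h1
  exact (ENNReal.mul_pos (Nat.cast_ne_zero.2 hn) (F.fiberVolume_fiber_ball_pos x).ne').ne h1

end FinslerStructure

end FiberVolume

/-! ### Averages of integrands that are constant on the indicatrix -/

section Average

variable {n : ℕ} {M : Type*} [TopologicalSpace M] [ChartedSpace (Model n) M]
  [IsManifold (𝓡 n) ∞ M]

/-- The average of a connection along vector fields whose covariant derivatives agree at all points
of the fibre is the common value. -/
theorem FinslerStructure.average_apply_of_const (F : FinslerStructure n M) (hn : n ≠ 0)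
    (D : PullbackConnection n M) (Y : Π x : M, TangentSpace (𝓡 n) x) (x : M)
    (A : TangentSpace (𝓡 n) x →L[ℝ] TangentSpace (𝓡 n) x)
    (hA : ∀ (y : TangentSpace (𝓡 n) x) (hy : y ≠ 0) (X : TangentSpace (𝓡 n) x),
      D (pullbackField Y) (slitPoint x y hy) (F.horizontalLift (slitPoint x y hy) X) = A X) :
    F.average D Y x = A := by
  have : Nonempty (Fin n) := Fin.pos_iff_nonempty.1 (Nat.pos_of_ne_zero hn)
  have : Nontrivial (Model n) := inferInstance
  have := F.isFiniteMeasure_indicatrixVolume x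
  have := F.neZero_indicatrixVolume x hn
  refine Eq.trans ?_ (average_const (F.indicatrixVolume x) (show Model n →L[ℝ] Model n from A))
  rw [average]
  congr 1
  -- The integrand equals `A` at every point of `I_x`, so no separate integrability argument is
  -- needed.
  funext y
  exact ContinuousLinearMap.ext (hA y.1 (ne_zero_of_mem_indicatrix y.2))

/-- If the coefficients of a connection in the preferred charts do not depend on `y`, the connection
is the pull-back of its average. -/
theorem FinslerStructure.pullbackConnection_average_connectionOfCoeff (F : FinslerStructure n M)
    (G : Slit n M → Fin n → Fin n → Fin n → ℝ)
    (hG : ∀ (x : M) (y y' : TangentSpace (𝓡 n) x) (hy : y ≠ 0) (hy' : y' ≠ 0),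
      G (slitPoint x y hy) = G (slitPoint x y' hy')) :
    pullbackConnection (F.average (connectionOfCoeff G)) = connectionOfCoeff G := by
  unfold pullbackConnection
  -- Both connections come from `connectionOfCoeff`, so it suffices to compare coefficients.
  congr 1
  funext u i j k
  obtain ⟨⟨x, y⟩, hy⟩ := u
  -- An index `i` exists only in positive dimension; for `n = 0` there is nothing to compare.
  have hn : n ≠ 0 := (Fin.pos i).ne'
  have havg := F.average_apply_of_const hn (connectionOfCoeff G)
    (coordField (chartAt (Model n) x) j) x
    ((connectionOfCoeff G (pullbackField (coordField (chartAt (Model n) x) j))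
      (slitPoint x y hy)).comp (F.horizontalLift (slitPoint x y hy)))
    fun y' hy' X => F.connectionOfCoeff_horizontalLift_congr G _ x
      (mdifferentiableAt_coordField x j) y' y hy' hy (hG x y' y hy' hy) X
  have hval := congrArg (fun A => component (chartAt (Model n) x)
    (A (coordField (chartAt (Model n) x) k x)) i) havg
  refine hval.trans ?_
  exact component_connectionOfCoeff G (slitPoint x y hy) i j k _
    (mfderiv_slitProj_horizontalLift F (slitPoint x y hy) _)

end Average

end Finsler

end

/-! ### The two implications -/

theorem proposition5p3p4 {n : ℕ} {M : Type*} [TopologicalSpace M]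
    [ChartedSpace (Finsler.Model n) M] [IsManifold (𝓡 n) ∞ M]
    (F : Finsler.FinslerStructure n M) :
    F.IsBerwald ↔
      Finsler.pullbackConnection (F.average F.chernConnection) = F.chernConnection := by
  constructor
  · intro h
    refine F.pullbackConnection_average_connectionOfCoeff _ fun x y y' hy hy' => ?_
    funext i j k
    -- The preferred chart suffices here: its coefficients are the ones that define the Chern
    -- connection over `x`.
    have hB := h (chartAt (Finsler.Model n) x) (IsManifold.chart_mem_maximalAtlas x) x
      (mem_chart_source _ x) y y' hy hy' i j k
    have hcoeff : ∀ (z : TangentSpace (𝓡 n) x) (hz : z ≠ 0),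
        F.connectionCoeff F.chernConnection (chartAt (Finsler.Model n) x)
          (Finsler.slitPoint x z hz) i j k
        = Finsler.chernCoeff (F.inChart (chartAt (Finsler.Model n) x)) i j k
          (Finsler.natCoord (chartAt (Finsler.Model n) x) ⟨x, z⟩) := fun z hz =>
      Finsler.component_connectionOfCoeff _ (Finsler.slitPoint x z hz) i j k _
        (Finsler.mfderiv_slitProj_horizontalLift F (Finsler.slitPoint x z hz) _)
    rw [hcoeff y hy, hcoeff y' hy'] at hB
    exact hB
  · intro h φ hφ x hx y y' hy hy' i j k
    rw [← h]
    -- The coefficients of a pull-back see `u` only through `π(u)`, so at two points of one fibre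
    -- they agree by `rfl`.
    exact F.connectionCoeff_slitPoint_eq _ hφ hx y y' hy hy' rfl i j k
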